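/- Let $R$ be a ring (associative with $1$, not necessarily commutative). Modules are right $R$-modules, and maps are composed from left to right ($st$ means first $s$, then $t$). Let $\mathrm{fpmod}(R)$ be the category of finitely presented right $R$-modules. A set $\sigma$ of maps in $\mathrm{fpmod}(R)$ is a \emph{severe right Ore set} if it contains all isomorphisms; is closed under composition; is closed under pushout (if $s\colon A\to B$ is in $\sigma$ and $a\colon A\to C$ is any map, then the pushout $C\to B\sqcup_A C$ of $s$ along $a$ is in $\sigma$); and is severely right revengeful (if $s\colon A\to B$ is in $\sigma$ and $a\colon B\to C$ satisfies $sa=0$, then the canonical map $C\to\operatorname{coker} a$ is in $\sigma$). Let $\Sigma$ be a set of maps between finitely generated projective right $R$-modules, let $\sigma$ be the severe right Ore set generated by $\Sigma$, that is, the smallest severe right Ore set in $\mathrm{fpmod}(R)$ that contains $\Sigma$, and let $R\to R_\Sigma$ be the universal localisation of $R$ at $\Sigma$, that is, the universal ring homomorphism $R\to S$ such that $\alpha\otimes_R S$ is an isomorphism for every $\alpha\in\Sigma$. For a finitely presented right $R$-module $M$ let ${}_M\sigma$ be the category whose objects are the maps $s\colon M\to M_s$ in $\sigma$ that begin at $M$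 and whose morphisms from $s$ to $u$ are the maps $t\colon M_s\to M_u$ in $\sigma$ with $st=u$, and let $$M_\sigma=\varinjlim_{s\in{}_M\sigma}M_s ,$$ the direct limit of right $R$-modules, with canonical map $\iota_1\colon M\to M_\sigma$ from the term at $s=1_M$. Then for every finitely presented right $R$-module $M$ there is an isomorphism of right $R$-modules $$M\otimes_R R_\Sigma\;\cong\;M_\sigma ,$$ and it can be chosen canonically, so that $m\otimes 1$ corresponds to $\iota_1(m)$ for all $m\in M$. -/

import Mathlib

open CategoryTheory CategoryTheory.Limits MulOpposite
open scoped TensorProduct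

universe v u w w'

/-! ## Severe right Ore sets

Composition `s ≫ t` means first `s`, then `t`. -/

/-- A set of maps `σ` in a category `A` is a severe right Ore set if it contains the isomorphisms,
is closed under composition and pushout, and contains the cokernel of every map `a` that is killed
on the left by some `s ∈ σ` (that is, `s ≫ a = 0`). As `σ` contains the isomorphisms and is closed
under composition, it does not matter which pushout or which cokernel is taken. -/
structure IsSevereRightOre {A : Type u} [Category.{v} A] [HasZeroMorphisms A]
    (σ : MorphismProperty A) : Prop where
  iso_mem : ∀ ⦃X Y : A⦄ (f : X ⟶ Y), IsIso f → σ f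
  comp_mem : ∀ ⦃X Y Z : A⦄ (s : X ⟶ Y) (t : Y ⟶ Z), σ s → σ t → σ (s ≫ t)
  pushout_mem : ∀ ⦃X Y Z W : A⦄ (s : X ⟶ Y) (a : X ⟶ Z) (a' : Y ⟶ W) (s' : Z ⟶ W),
    IsPushout s a a' s' → σ s → σ s'
  cokernel_mem : ∀ ⦃X Y Z W : A⦄ (s : X ⟶ Y) (a : Y ⟶ Z) (t : Z ⟶ W) (h : a ≫ t = 0),
    σ s → s ≫ a = 0 → Nonempty (IsColimit (CokernelCofork.ofπ t h)) → σ t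

/-- The severe right Ore set generated by a set of maps: the smallest one that contains it. -/
def severeClosure {A : Type u} [Category.{v} A] [HasZeroMorphisms A]
    (Sig : MorphismProperty A) : MorphismProperty A :=
  fun _ _ f => ∀ σ : MorphismProperty A, IsSevereRightOre σ → Sig ≤ σ → σ f

theorem severeClosure_isSevereRightOre {A : Type u} [Category.{v} A] [HasZeroMorphisms A]
    (Sig : MorphismProperty A) : IsSevereRightOre (severeClosure Sig) where
  iso_mem _ _ f hf _ hσ _ := hσ.iso_mem f hf
  comp_mem _ _ _ s t hs ht σ hσ h := hσ.comp_mem s t (hs σ hσ h) (ht σ hσ h)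
  pushout_mem _ _ _ _ s a a' s' hp hs σ hσ h := hσ.pushout_mem s a a' s' hp (hs σ hσ h)
  cokernel_mem _ _ _ _ s a t hat hs hsa ht σ hσ h :=
    hσ.cokernel_mem s a t hat (hs σ hσ h) hsa ht

instance severeClosure_isMultiplicative {A : Type u} [Category.{v} A] [HasZeroMorphisms A]
    (Sig : MorphismProperty A) : (severeClosure Sig).IsMultiplicative where
  id_mem X := (severeClosure_isSevereRightOre Sig).iso_mem (𝟙 X) inferInstance
  comp_mem s t hs ht := (severeClosure_isSevereRightOre Sig).comp_mem s t hs ht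

instance severeClosure_respectsIso {A : Type u} [Category.{v} A] [HasZeroMorphisms A]
    (Sig : MorphismProperty A) : (severeClosure Sig).RespectsIso where
  precomp i hi f hf := (severeClosure_isSevereRightOre Sig).comp_mem i f
    ((severeClosure_isSevereRightOre Sig).iso_mem i hi) hf
  postcomp i hi f hf := (severeClosure_isSevereRightOre Sig).comp_mem f i hf
    ((severeClosure_isSevereRightOre Sig).iso_mem i hi)

/-! ## Finitely presented modules and the direct limit `M_σ`

A right `R`-module is a module over `Rᵐᵒᵖ`; `op r • x` is `x r`. -/

/-- The category of finitely presented right `R`-modules. -/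
abbrev FPMod (R : Type u) [Ring R] : Type (u + 1) :=
  ObjectProperty.FullSubcategory
    (fun M : ModuleCat.{u} Rᵐᵒᵖ => Module.FinitePresentation Rᵐᵒᵖ M)

instance FPMod.essentiallySmall (R : Type u) [Ring R] : EssentiallySmall.{u} (FPMod R) := by
  have hle : (fun M : ModuleCat.{u} Rᵐᵒᵖ => Module.FinitePresentation Rᵐᵒᵖ M) ≤
      ModuleCat.isFG.{u} Rᵐᵒᵖ :=
    fun M (hM : Module.FinitePresentation Rᵐᵒᵖ M) => (inferInstance : Module.Finite Rᵐᵒᵖ M)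
  have := (ObjectProperty.fullyFaithfulιOfLE hle).full
  have := (ObjectProperty.fullyFaithfulιOfLE hle).faithful
  have : EssentiallySmall.{u} (ModuleCat.isFG.{u} Rᵐᵒᵖ).FullSubcategory :=
    inferInstanceAs (EssentiallySmall.{u} (FGModuleCat.{u} Rᵐᵒᵖ))
  exact essentiallySmall_of_fully_faithful (ObjectProperty.ιOfLE hle)

/-- The system `(M_s)` over the maps `s : M ⟶ M_s` in `σ`: the index category `σ.Under σ M` has
as objects the maps `s` in `σ` that begin at `M`, and as morphisms from `s` to `u` the maps `t` in
`σ` with `s ≫ t = u`. -/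
def limitSystem {R : Type u} [Ring R] (σ : MorphismProperty (FPMod R)) [σ.IsMultiplicative]
    (M : FPMod R) : σ.Under σ M ⥤ ModuleCat.{u} Rᵐᵒᵖ :=
  MorphismProperty.Under.forget σ σ M ⋙ CategoryTheory.Under.forget M ⋙ ObjectProperty.ι _

instance limitSystem_index_essentiallySmall {R : Type u} [Ring R] (σ : MorphismProperty (FPMod R))
    [σ.IsMultiplicative] [σ.RespectsIso] (M : FPMod R) :
    EssentiallySmall.{u} (σ.Under σ M) := by
  rw [essentiallySmall_iff]
  constructor
  · let e := equivSmallModel.{u} (FPMod R)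
    let T : Type u := Σ j : SmallModel.{u} (FPMod R), {f : M ⟶ e.inverse.obj j // σ f}
    let F : T → Skeleton (σ.Under σ M) := fun x =>
      toSkeleton (MorphismProperty.Under.mk σ x.2.1 x.2.2)
    refine small_of_surjective (f := F) fun X => ?_
    obtain ⟨Y, rfl⟩ := Quotient.exists_rep X
    let i : Y.right ≅ e.inverse.obj (e.functor.obj Y.right) := e.unitIso.app Y.right
    have hi : σ (Y.hom ≫ i.hom) :=
      (MorphismProperty.cancel_right_of_respectsIso σ _ _).2 Y.prop
    refine ⟨⟨e.functor.obj Y.right, Y.hom ≫ i.hom, hi⟩, ?_⟩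
    let E : Y ≅ MorphismProperty.Under.mk σ (Y.hom ≫ i.hom) hi :=
      MorphismProperty.Under.isoMk i rfl
    exact Quotient.sound ⟨E.symm⟩
  · exact ⟨fun X Y => small_of_injective
      (f := fun t : X ⟶ Y => (t.right : X.right ⟶ Y.right))
      fun _ _ h => MorphismProperty.Under.Hom.ext h⟩

instance limitSystem_hasColimit {R : Type u} [Ring R] (σ : MorphismProperty (FPMod R))
    [σ.IsMultiplicative] [σ.RespectsIso] (M : FPMod R) : HasColimit (limitSystem σ M) :=
  haveI : HasColimitsOfShape (σ.Under σ M) (ModuleCat.{u} Rᵐᵒᵖ) :=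
    hasColimitsOfShape_of_essentiallySmall.{u} _ _
  inferInstance

/-- The right `R`-module `M_σ`, the direct limit of the codomains of the maps in `σ` that begin
at `M`. -/
noncomputable def dirLim {R : Type u} [Ring R] (σ : MorphismProperty (FPMod R))
    [σ.IsMultiplicative] [σ.RespectsIso] (M : FPMod R) : ModuleCat.{u} Rᵐᵒᵖ :=
  colimit (limitSystem σ M)

/-- The canonical map `M_s ⟶ M_σ` for a map `s : M ⟶ M_s` in `σ`. -/
noncomputable def dirLim.ι {R : Type u} [Ring R] (σ : MorphismProperty (FPMod R))
    [σ.IsMultiplicative] [σ.RespectsIso] {M N : FPMod R} (s : M ⟶ N) (hs : σ s) :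
    N.obj ⟶ dirLim σ M :=
  colimit.ι (limitSystem σ M) (MorphismProperty.Under.mk σ s hs)

/-! ## Induced modules over a noncommutative ring -/

section Induced

variable {R : Type u} {S : Type w} [Ring R] [Ring S] (h : R →+* S)

/-- The relations `(m r) ⊗ s = m ⊗ (h r) s` between pure tensors over `ℤ`. The tensor product over
`ℤ` is written with the factor `S` first, so that its right `S`-module structure is Mathlib's. -/
def inducedRel (M : Type w') [AddCommGroup M] [Module Rᵐᵒᵖ M] : Submodule Sᵐᵒᵖ (S ⊗[ℤ] M) :=
  Submodule.span Sᵐᵒᵖ {x | ∃ (m : M) (r : R) (s : S), x = s ⊗ₜ (op r • m) - (h r * s) ⊗ₜ m}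

/-- The right `S`-module `M ⊗_R S` induced from the right `R`-module `M` along `h : R →+* S`. -/
abbrev Induced (M : Type w') [AddCommGroup M] [Module Rᵐᵒᵖ M] : Type (max w w') :=
  (S ⊗[ℤ] M) ⧸ inducedRel h M

namespace Induced

variable (M : Type w') [AddCommGroup M] [Module Rᵐᵒᵖ M]

variable {M}

/-- The element `m ⊗ s` of `M ⊗_R S`. -/
def tmul (m : M) (s : S) : Induced h M :=
  (inducedRel h M).mkQ (s ⊗ₜ m)

theorem tmul_smul (m : M) (r : R) (s : S) : tmul h (op r • m) s = tmul h m (h r * s) := by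
  unfold tmul
  rw [← sub_eq_zero, ← map_sub, Submodule.mkQ_apply, Submodule.Quotient.mk_eq_zero]
  exact Submodule.subset_span ⟨m, r, s, rfl⟩

theorem smul_tmul (m : M) (s t : S) : op t • tmul h m s = tmul h m (s * t) := by
  unfold tmul
  rw [← map_smul, TensorProduct.smul_tmul', op_smul_eq_mul]

theorem add_tmul (m m' : M) (s : S) : tmul h (m + m') s = tmul h m s + tmul h m' s := by
  unfold tmul
  rw [TensorProduct.tmul_add, map_add]

theorem tmul_add (m : M) (s s' : S) : tmul h m (s + s') = tmul h m s + tmul h m s' := by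
  unfold tmul
  rw [TensorProduct.add_tmul, map_add]

/-- `m ↦ m ⊗ 1` as an additive map. -/
def unit : M →+ Induced h M where
  toFun m := tmul h m 1
  map_zero' := by simp [tmul]
  map_add' m m' := add_tmul h m m' 1

theorem unit_apply (m : M) : unit h m = tmul h m 1 := rfl

theorem unit_smul (m : M) (r : R) : unit h (op r • m) = op (h r) • unit h m := by
  simp only [unit_apply, tmul_smul, smul_tmul, mul_one, one_mul]

theorem tmul_eq (m : M) (s : S) : tmul h m s = op s • unit h m := by
  rw [unit_apply, smul_tmul, one_mul]

variable {A : Type*} [AddCommGroup A] [Module Sᵐᵒᵖ A]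

theorem induction_on {p : Induced h M → Prop} (x : Induced h M)
    (unit : ∀ (m : M) (s : S), p (op s • Induced.unit h m))
    (add : ∀ x y, p x → p y → p (x + y)) : p x := by
  obtain ⟨x, rfl⟩ := (inducedRel h M).mkQ_surjective x
  induction x with
  | zero => simpa using unit 0 0
  | add x y hx hy => rw [map_add]; exact add _ _ hx hy
  | tmul s m =>
    have key : (inducedRel h M).mkQ (s ⊗ₜ m) = op s • Induced.unit h m := tmul_eq h m s
    rw [key]
    exact unit m s

theorem hom_ext {f g : Induced h M →ₗ[Sᵐᵒᵖ] A}
    (hfg : ∀ m, f (unit h m) = g (unit h m)) : f = g := by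
  refine LinearMap.ext fun x => ?_
  induction x using induction_on with
  | add x y hx hy => simp only [map_add, hx, hy]
  | unit m s => rw [map_smul, map_smul, hfg]

/-- The universal property of `M ⊗_R S`: it is the free right `S`-module on the right
`R`-module `M`. -/
def lift (φ : M →+ A) (hφ : ∀ m r, φ (op r • m) = op (h r) • φ m) :
    Induced h M →ₗ[Sᵐᵒᵖ] A :=
  (inducedRel h M).liftQ
    { toFun := TensorProduct.liftAddHom
        (AddMonoidHom.mk' (fun s : S =>
            AddMonoidHom.mk' (fun m : M => op s • φ m) (by intro a b; simp))
          (by intro a b; ext m; simp [add_smul]))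
        (by
          intro n s m
          change op (n • s) • φ m = op s • φ (n • m)
          rw [op_smul, smul_assoc, map_zsmul, smul_comm])
      map_add' := map_add _
      map_smul' := by
        intro t x
        induction x with
        | zero => simp
        | add x y hx hy => simp only [smul_add, map_add, hx, hy]
        | tmul s m =>
          obtain ⟨t, rfl⟩ := op_surjective t
          simp [TensorProduct.smul_tmul', mul_smul] }
    (by
      unfold inducedRel
      rw [Submodule.span_le]
      rintro _ ⟨m, r, s, rfl⟩
      simp [hφ, mul_smul])

theorem lift_tmul (φ : M →+ A) (hφ : ∀ m r, φ (op r • m) = op (h r) • φ m) (m : M) (s : S) :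
    lift h φ hφ (tmul h m s) = op s • φ m := by
  rfl

theorem lift_unit (φ : M →+ A) (hφ : ∀ m r, φ (op r • m) = op (h r) • φ m) (m : M) :
    lift h φ hφ (unit h m) = φ m := by
  rw [unit_apply, lift_tmul, op_one, one_smul]

variable {N : Type*} [AddCommGroup N] [Module Rᵐᵒᵖ N]

/-- The map `α ⊗_R S : M ⊗_R S → N ⊗_R S`, which sends `m ⊗ s` to `α m ⊗ s`. -/
def map (α : M →ₗ[Rᵐᵒᵖ] N) : Induced h M →ₗ[Sᵐᵒᵖ] Induced h N :=
  lift h ((unit h).comp α.toAddMonoidHom) (fun m r => by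
    change unit h (α (op r • m)) = op (h r) • unit h (α m)
    rw [map_smul, unit_smul])

theorem map_unit (α : M →ₗ[Rᵐᵒᵖ] N) (m : M) : map h α (unit h m) = unit h (α m) :=
  lift_unit h _ _ m

theorem map_tmul (α : M →ₗ[Rᵐᵒᵖ] N) (m : M) (s : S) :
    map h α (tmul h m s) = tmul h (α m) s := by
  rw [tmul_eq, map_smul, map_unit, ← tmul_eq]

end Induced

end Induced

/-! ## The universal localisation `R_Σ` -/

/-- The ring homomorphism `h : R →+* S` inverts every map `α` in `Sig`: each `α ⊗_R S` is an
isomorphism. -/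
def InvertsMaps {R : Type u} [Ring R] {S : Type w} [Ring S] (h : R →+* S)
    (Sig : MorphismProperty (FPMod R)) : Prop :=
  ∀ ⦃P Q : FPMod R⦄ (α : P ⟶ Q), Sig α → Function.Bijective (Induced.map h α.hom.hom)

namespace UnivLoc

/-- The generators of `R_Σ` over `R`: for `α : P ⟶ Q` in `Sig`, `f ∈ P* = Hom_R(P, R)` and `q ∈ Q`
a generator `[f, q]`, which stands for the "matrix coefficient" `f (α⁻¹ q)` of the inverse of
`α`. -/
structure Gen {R : Type u} [Ring R] (Sig : MorphismProperty (FPMod R)) : Type (u + 1) where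
  P : FPMod R
  Q : FPMod R
  α : P ⟶ Q
  mem : Sig α
  f : P.obj →ₗ[Rᵐᵒᵖ] R
  q : Q.obj

/-- The element of `R` in the free ring on `R` and the generators. -/
abbrev r {R : Type u} [Ring R] (Sig : MorphismProperty (FPMod R)) (x : R) :
    FreeAlgebra ℤ (R ⊕ Gen Sig) :=
  FreeAlgebra.ι ℤ (Sum.inl x)

/-- The generator `[f, q]` in the free ring on `R` and the generators. -/
abbrev g {R : Type u} [Ring R] {Sig : MorphismProperty (FPMod R)} {P Q : FPMod R} {α : P ⟶ Q}
    (hα : Sig α) (f : P.obj →ₗ[Rᵐᵒᵖ] R) (q : Q.obj) : FreeAlgebra ℤ (R ⊕ Gen Sig) :=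
  FreeAlgebra.ι ℤ (Sum.inr ⟨P, Q, α, hα, f, q⟩)

/-- The defining relations of `R_Σ`: those of the ring `R`; bilinearity of `[f, q]`;
`[f, α p] = f p`; and, for every dual basis `(p_i, φ_i)` of `P`,
`∑ i, k (α p_i) [φ_i, q] = k q` for all `k ∈ Q*` and `q ∈ Q`. -/
inductive Rel {R : Type u} [Ring R] (Sig : MorphismProperty (FPMod R)) :
    FreeAlgebra ℤ (R ⊕ Gen Sig) → FreeAlgebra ℤ (R ⊕ Gen Sig) → Prop
  | one : Rel Sig (r Sig 1) 1
  | add (x y : R) : Rel Sig (r Sig (x + y)) (r Sig x + r Sig y)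
  | mul (x y : R) : Rel Sig (r Sig (x * y)) (r Sig x * r Sig y)
  | add_left {P Q : FPMod R} {α : P ⟶ Q} (hα : Sig α) (f f' : P.obj →ₗ[Rᵐᵒᵖ] R) (q : Q.obj) :
      Rel Sig (g hα (f + f') q) (g hα f q + g hα f' q)
  | add_right {P Q : FPMod R} {α : P ⟶ Q} (hα : Sig α) (f : P.obj →ₗ[Rᵐᵒᵖ] R) (q q' : Q.obj) :
      Rel Sig (g hα f (q + q')) (g hα f q + g hα f q')
  | smul_left {P Q : FPMod R} {α : P ⟶ Q} (hα : Sig α) (x : R) (f : P.obj →ₗ[Rᵐᵒᵖ] R)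
      (q : Q.obj) : Rel Sig (g hα (x • f) q) (r Sig x * g hα f q)
  | smul_right {P Q : FPMod R} {α : P ⟶ Q} (hα : Sig α) (f : P.obj →ₗ[Rᵐᵒᵖ] R) (q : Q.obj)
      (x : R) : Rel Sig (g hα f (op x • q)) (g hα f q * r Sig x)
  | inv_left {P Q : FPMod R} {α : P ⟶ Q} (hα : Sig α) (f : P.obj →ₗ[Rᵐᵒᵖ] R) (p : P.obj) :
      Rel Sig (g hα f (α.hom.hom p)) (r Sig (f p))
  | inv_right {P Q : FPMod R} {α : P ⟶ Q} (hα : Sig α) {n : ℕ} (p : Fin n → P.obj)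
      (φ : Fin n → (P.obj →ₗ[Rᵐᵒᵖ] R)) (hpφ : ∀ x : P.obj, ∑ i, op (φ i x) • p i = x)
      (k : Q.obj →ₗ[Rᵐᵒᵖ] R) (q : Q.obj) :
      Rel Sig (∑ i, r Sig (k (α.hom.hom (p i))) * g hα (φ i) q) (r Sig (k q))

end UnivLoc

/-- The universal localisation `R_Σ` of `R` at a set `Sig` of maps between finitely generated
projective right `R`-modules, by generators and relations. It is the universal ring over `R` that
inverts `Sig`: see `UnivLoc.invertsMaps` and `UnivLoc.existsUnique_lift`. -/
def UnivLoc {R : Type u} [Ring R] (Sig : MorphismProperty (FPMod R)) : Type (u + 1) :=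
  RingQuot (UnivLoc.Rel Sig)

namespace UnivLoc

variable {R : Type u} [Ring R] (Sig : MorphismProperty (FPMod R))

noncomputable instance : Ring (UnivLoc Sig) :=
  inferInstanceAs (Ring (RingQuot (UnivLoc.Rel Sig)))

/-- The quotient map from the free ring. -/
noncomputable def mk : FreeAlgebra ℤ (R ⊕ Gen Sig) →+* UnivLoc Sig :=
  RingQuot.mkRingHom (Rel Sig)

theorem mk_rel {x y : FreeAlgebra ℤ (R ⊕ Gen Sig)} (hxy : Rel Sig x y) : mk Sig x = mk Sig y :=
  RingQuot.mkRingHom_rel hxy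

/-- The canonical ring homomorphism `R → R_Σ`. -/
noncomputable def of : R →+* UnivLoc Sig :=
  RingHom.mk' ⟨⟨fun x => mk Sig (r Sig x), by rw [mk_rel Sig Rel.one, map_one]⟩,
    fun x y => by
      change mk Sig (r Sig (x * y)) = mk Sig (r Sig x) * mk Sig (r Sig y)
      rw [mk_rel Sig (Rel.mul x y), map_mul]⟩
    (fun x y => by
      change mk Sig (r Sig (x + y)) = mk Sig (r Sig x) + mk Sig (r Sig y)
      rw [mk_rel Sig (Rel.add x y), map_add])

theorem of_apply (x : R) : of Sig x = mk Sig (r Sig x) := rfl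

/-- The generator `[f, q]` of `R_Σ`, additive in `q`. -/
noncomputable def coeff {P Q : FPMod R} {α : P ⟶ Q} (hα : Sig α) (f : P.obj →ₗ[Rᵐᵒᵖ] R) :
    Q.obj →+ UnivLoc Sig :=
  AddMonoidHom.mk' (fun q => mk Sig (g hα f q)) (fun q q' => by
    rw [mk_rel Sig (Rel.add_right hα f q q'), map_add])

theorem coeff_apply {P Q : FPMod R} {α : P ⟶ Q} (hα : Sig α) (f : P.obj →ₗ[Rᵐᵒᵖ] R) (q : Q.obj) :
    coeff Sig hα f q = mk Sig (g hα f q) := rfl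

theorem coeff_smul {P Q : FPMod R} {α : P ⟶ Q} (hα : Sig α) (f : P.obj →ₗ[Rᵐᵒᵖ] R) (q : Q.obj)
    (x : R) : coeff Sig hα f (op x • q) = coeff Sig hα f q * of Sig x := by
  rw [coeff_apply, mk_rel Sig (Rel.smul_right hα f q x), map_mul]; rfl

theorem smul_coeff {P Q : FPMod R} {α : P ⟶ Q} (hα : Sig α) (f : P.obj →ₗ[Rᵐᵒᵖ] R) (q : Q.obj)
    (x : R) : coeff Sig hα (x • f) q = of Sig x * coeff Sig hα f q := by
  rw [coeff_apply, mk_rel Sig (Rel.smul_left hα x f q), map_mul]; rfl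

theorem add_coeff {P Q : FPMod R} {α : P ⟶ Q} (hα : Sig α) (f f' : P.obj →ₗ[Rᵐᵒᵖ] R) (q : Q.obj) :
    coeff Sig hα (f + f') q = coeff Sig hα f q + coeff Sig hα f' q := by
  rw [coeff_apply, mk_rel Sig (Rel.add_left hα f f' q), map_add]; rfl

theorem coeff_map {P Q : FPMod R} {α : P ⟶ Q} (hα : Sig α) (f : P.obj →ₗ[Rᵐᵒᵖ] R) (p : P.obj) :
    coeff Sig hα f (α.hom.hom p) = of Sig (f p) := by
  rw [coeff_apply, mk_rel Sig (Rel.inv_left hα f p)]; rfl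

theorem coeff_sum {P Q : FPMod R} {α : P ⟶ Q} (hα : Sig α) {n : ℕ} (p : Fin n → P.obj)
    (φ : Fin n → (P.obj →ₗ[Rᵐᵒᵖ] R)) (hpφ : ∀ x : P.obj, ∑ i, op (φ i x) • p i = x)
    (k : Q.obj →ₗ[Rᵐᵒᵖ] R) (q : Q.obj) :
    ∑ i, of Sig (k (α.hom.hom (p i))) * coeff Sig hα (φ i) q = of Sig (k q) := by
  have := mk_rel Sig (Rel.inv_right hα p φ hpφ k q)
  rw [map_sum] at this
  simp only [map_mul] at this
  exact this

theorem exists_dualBasis (P : FPMod R) [Module.Projective Rᵐᵒᵖ P.obj] :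
    ∃ (n : ℕ) (p : Fin n → P.obj) (φ : Fin n → (P.obj →ₗ[Rᵐᵒᵖ] R)),
      ∀ x : P.obj, ∑ i, op (φ i x) • p i = x := by
  have : Module.FinitePresentation Rᵐᵒᵖ P.obj := P.property
  obtain ⟨n, π, hπ⟩ := Module.Finite.exists_fin' Rᵐᵒᵖ P.obj
  obtain ⟨ψ, hψ⟩ := Module.projective_lifting_property π LinearMap.id hπ
  refine ⟨n, fun i => π (Pi.single i 1), fun i =>
    { toFun := fun x => unop (ψ x i)
      map_add' := by simp
      map_smul' := by intro c x; simp }, fun x => ?_⟩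
  have h1 : π (ψ x) = x := LinearMap.congr_fun hψ x
  conv_rhs => rw [← h1, pi_eq_sum_univ' (ψ x), map_sum]
  refine Finset.sum_congr rfl fun i _ => ?_
  rw [← map_smul]
  simp

theorem dualBasis_expand {S : Type w} [Ring S] (h : R →+* S) {P : FPMod R} {n : ℕ}
    (p : Fin n → P.obj) (φ : Fin n → (P.obj →ₗ[Rᵐᵒᵖ] R))
    (hpφ : ∀ x : P.obj, ∑ i, op (φ i x) • p i = x) (x : P.obj) :
    ∑ i, op (h (φ i x)) • Induced.unit h (p i) = Induced.unit h x := by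
  conv_rhs => rw [← hpφ x, map_sum]
  simp only [Induced.unit_smul]

/-- The inverse of `α ⊗ R_Σ`, in terms of a dual basis. -/
noncomputable def invMap {P Q : FPMod R} {α : P ⟶ Q} (hα : Sig α) {n : ℕ} (p : Fin n → P.obj)
    (φ : Fin n → (P.obj →ₗ[Rᵐᵒᵖ] R)) :
    Induced (of Sig) Q.obj →ₗ[(UnivLoc Sig)ᵐᵒᵖ] Induced (of Sig) P.obj :=
  Induced.lift (of Sig)
    (AddMonoidHom.mk' (fun q => ∑ i, op (coeff Sig hα (φ i) q) • Induced.unit (of Sig) (p i))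
      (fun q q' => by
        rw [← Finset.sum_add_distrib]
        refine Finset.sum_congr rfl fun i _ => ?_
        rw [map_add, MulOpposite.op_add, add_smul]))
    (fun q x => by
      simp only [AddMonoidHom.mk'_apply, coeff_smul, op_mul, mul_smul, Finset.smul_sum])

theorem invMap_unit {P Q : FPMod R} {α : P ⟶ Q} (hα : Sig α) {n : ℕ} (p : Fin n → P.obj)
    (φ : Fin n → (P.obj →ₗ[Rᵐᵒᵖ] R)) (q : Q.obj) :
    invMap Sig hα p φ (Induced.unit (of Sig) q) =
      ∑ i, op (coeff Sig hα (φ i) q) • Induced.unit (of Sig) (p i) :=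
  Induced.lift_unit _ _ _ q

theorem map_invMap {P Q : FPMod R} [Module.Projective Rᵐᵒᵖ Q.obj] {α : P ⟶ Q} (hα : Sig α)
    {n : ℕ} (p : Fin n → P.obj) (φ : Fin n → (P.obj →ₗ[Rᵐᵒᵖ] R))
    (hpφ : ∀ x : P.obj, ∑ i, op (φ i x) • p i = x) (q : Q.obj) :
    ∑ i, op (coeff Sig hα (φ i) q) • Induced.unit (of Sig) (α.hom.hom (p i)) =
      Induced.unit (of Sig) q := by
  obtain ⟨m, b, ψ, hb⟩ := exists_dualBasis Q
  rw [← dualBasis_expand (of Sig) b ψ hb q]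
  have e (i : Fin n) := (dualBasis_expand (of Sig) b ψ hb (α.hom.hom (p i))).symm
  simp only [e, Finset.smul_sum]
  rw [Finset.sum_comm]
  refine Finset.sum_congr rfl fun j _ => ?_
  rw [← coeff_sum Sig hα p φ hpφ (ψ j) q]
  simp only [← mul_smul, ← op_mul, Finset.sum_smul, Finset.op_sum]

/-- `R → R_Σ` inverts `Σ`. -/
theorem invertsMaps (hSig : ∀ ⦃P Q : FPMod R⦄ (α : P ⟶ Q), Sig α →
      Module.Projective Rᵐᵒᵖ P.obj ∧ Module.Projective Rᵐᵒᵖ Q.obj) :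
    InvertsMaps (of Sig) Sig := by
  intro P Q α hα
  obtain ⟨_, _⟩ := hSig α hα
  obtain ⟨n, p, φ, hpφ⟩ := exists_dualBasis P
  have h1 : invMap Sig hα p φ ∘ₗ Induced.map (of Sig) α.hom.hom = LinearMap.id := by
    apply Induced.hom_ext
    intro x
    simp only [LinearMap.comp_apply, Induced.map_unit, invMap_unit, coeff_map, LinearMap.id_apply]
    exact dualBasis_expand (of Sig) p φ hpφ x
  have h2 : Induced.map (of Sig) α.hom.hom ∘ₗ invMap Sig hα p φ = LinearMap.id := by
    apply Induced.hom_ext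
    intro q
    simp only [LinearMap.comp_apply, invMap_unit, map_sum, map_smul, Induced.map_unit,
      LinearMap.id_apply]
    exact map_invMap Sig hα p φ hpφ q
  exact Function.bijective_iff_has_inverse.2
    ⟨invMap Sig hα p φ, LinearMap.congr_fun h1, LinearMap.congr_fun h2⟩

/-- The map `f ⊗ S : P ⊗_R S → R ⊗_R S = S`, which sends `p ⊗ s` to `h (f p) s`. -/
def ev {S : Type w} [Ring S] (h : R →+* S) {P : FPMod R} (f : P.obj →ₗ[Rᵐᵒᵖ] R) :
    Induced h P.obj →ₗ[Sᵐᵒᵖ] S :=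
  Induced.lift h (h.toAddMonoidHom.comp f.toAddMonoidHom) (fun m x => by
    change h (f (op x • m)) = op (h x) • h (f m)
    rw [map_smul, op_smul_eq_mul, op_smul_eq_mul, map_mul])

theorem ev_unit {S : Type w} [Ring S] (h : R →+* S) {P : FPMod R} (f : P.obj →ₗ[Rᵐᵒᵖ] R)
    (x : P.obj) : ev h f (Induced.unit h x) = h (f x) :=
  Induced.lift_unit h _ _ x

theorem ev_add {S : Type w} [Ring S] (h : R →+* S) {P : FPMod R} (f f' : P.obj →ₗ[Rᵐᵒᵖ] R) :
    ev h (f + f') = ev h f + ev h f' := by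
  apply Induced.hom_ext
  intro m
  simp [ev_unit]

theorem ev_smul {S : Type w} [Ring S] (h : R →+* S) {P : FPMod R} (f : P.obj →ₗ[Rᵐᵒᵖ] R) (x : R)
    (y : Induced h P.obj) : ev h (x • f) y = h x * ev h f y := by
  induction y using Induced.induction_on with
  | unit m s =>
    simp only [map_smul, ev_unit, op_smul_eq_mul, LinearMap.smul_apply, smul_eq_mul, map_mul,
      mul_assoc]
  | add a b ha hb => simp only [map_add, ha, hb, mul_add]

/-- Every ring homomorphism `h : R → S` that inverts `Σ` factors uniquely through `R → R_Σ`. -/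
theorem existsUnique_lift (hSig : ∀ ⦃P Q : FPMod R⦄ (α : P ⟶ Q), Sig α →
      Module.Projective Rᵐᵒᵖ P.obj ∧ Module.Projective Rᵐᵒᵖ Q.obj)
    {S : Type w} [Ring S] (h : R →+* S) (hh : InvertsMaps h Sig) :
    ∃! k : UnivLoc Sig →+* S, k.comp (of Sig) = h := by
  let inv {P Q : FPMod R} {α : P ⟶ Q} (hα : Sig α) : Induced h Q.obj →ₗ[Sᵐᵒᵖ] Induced h P.obj :=
    (LinearEquiv.ofBijective (Induced.map h α.hom.hom) (hh α hα)).symm.toLinearMap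
  have inv_map {P Q : FPMod R} {α : P ⟶ Q} (hα : Sig α) (y : Induced h P.obj) :
      inv hα (Induced.map h α.hom.hom y) = y :=
    (LinearEquiv.ofBijective (Induced.map h α.hom.hom) (hh α hα)).symm_apply_apply y
  have map_inv {P Q : FPMod R} {α : P ⟶ Q} (hα : Sig α) (y : Induced h Q.obj) :
      Induced.map h α.hom.hom (inv hα y) = y :=
    (LinearEquiv.ofBijective (Induced.map h α.hom.hom) (hh α hα)).apply_symm_apply y
  have ev_map {P Q : FPMod R} (α : P ⟶ Q) (k : Q.obj →ₗ[Rᵐᵒᵖ] R) (y : Induced h P.obj) :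
      ev h k (Induced.map h α.hom.hom y) = ev h (k ∘ₗ α.hom.hom) y := by
    refine LinearMap.congr_fun (f := ev h k ∘ₗ Induced.map h α.hom.hom) ?_ y
    apply Induced.hom_ext
    intro m
    simp [ev_unit, Induced.map_unit]
  have expand {P : FPMod R} {n : ℕ} (p : Fin n → P.obj) (φ : Fin n → (P.obj →ₗ[Rᵐᵒᵖ] R))
      (hpφ : ∀ x : P.obj, ∑ i, op (φ i x) • p i = x) (f : P.obj →ₗ[Rᵐᵒᵖ] R) :
      f = ∑ i, f (p i) • φ i := by
    ext x
    conv_lhs => rw [← hpφ x, map_sum]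
    simp
  let val : R ⊕ Gen Sig → S := Sum.elim h fun c =>
    ev h c.f (inv c.mem (Induced.unit h c.q))
  let k₀ : FreeAlgebra ℤ (R ⊕ Gen Sig) →+* S := (FreeAlgebra.lift ℤ val).toRingHom
  have k_r (x : R) : k₀ (r Sig x) = h x := by
    change FreeAlgebra.lift ℤ val (FreeAlgebra.ι ℤ _) = _
    rw [FreeAlgebra.lift_ι_apply]; rfl
  have k_g {P Q : FPMod R} {α : P ⟶ Q} (hα : Sig α) (f : P.obj →ₗ[Rᵐᵒᵖ] R) (q : Q.obj) :
      k₀ (g hα f q) = ev h f (inv hα (Induced.unit h q)) := by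
    change FreeAlgebra.lift ℤ val (FreeAlgebra.ι ℤ _) = _
    rw [FreeAlgebra.lift_ι_apply]; rfl
  have hk₀ : ∀ ⦃x y⦄, Rel Sig x y → k₀ x = k₀ y := by
    intro x y hxy
    induction hxy with
    | one => rw [k_r, map_one, map_one]
    | add x y => simp only [map_add, k_r]
    | mul x y => simp only [map_mul, k_r]
    | add_left hα f f' q => simp only [map_add, k_g, ev_add, LinearMap.add_apply]
    | add_right hα f q q' => simp only [map_add, k_g]
    | smul_left hα x f q => simp only [map_mul, k_g, k_r, ev_smul]
    | smul_right hα f q x =>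
      simp only [map_mul, k_g, k_r, Induced.unit_smul, map_smul, op_smul_eq_mul]
    | inv_left hα f p => rw [k_g, k_r, ← Induced.map_unit, inv_map hα, ev_unit]
    | @inv_right P Q α hα n p φ hpφ k q =>
      simp only [map_sum, map_mul, k_g, k_r, ← ev_smul]
      rw [← ev_unit h k q, ← map_inv hα (Induced.unit h q), ev_map,
        expand p φ hpφ (k ∘ₗ α.hom.hom), inv_map hα]
      generalize inv hα (Induced.unit h q) = y
      induction y using Induced.induction_on with
      | unit m s => simp [ev_unit, Finset.sum_mul]
      | add a b ha hb => simp only [map_add, Finset.sum_add_distrib, ha, hb]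
  refine ⟨RingQuot.lift ⟨k₀, hk₀⟩, ?_, ?_⟩
  · ext x
    change RingQuot.lift ⟨k₀, hk₀⟩ (RingQuot.mkRingHom (Rel Sig) (r Sig x)) = h x
    rw [RingQuot.lift_mkRingHom_apply, k_r]
  · intro k hk
    have hk' (x : R) : k (of Sig x) = h x := RingHom.congr_fun hk x
    refine RingQuot.lift_unique k₀ hk₀ k ?_
    suffices H : (k.comp (mk Sig)).toIntAlgHom = FreeAlgebra.lift ℤ val from
      congrArg (fun z : FreeAlgebra ℤ (R ⊕ Gen Sig) →ₐ[ℤ] S => z.toRingHom) H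
    apply FreeAlgebra.hom_ext
    funext c
    rcases c with x | ⟨P, Q, α, hα, f, q⟩
    · exact (hk' x).trans (k_r x).symm
    · refine Eq.trans ?_ (k_g hα f q).symm
      change k (coeff Sig hα f q) = _
      obtain ⟨_, _⟩ := hSig α hα
      obtain ⟨n, p, φ, hpφ⟩ := exists_dualBasis P
      obtain ⟨m, b, ψ, hb⟩ := exists_dualBasis Q
      have key : Induced.map h α.hom.hom (∑ i, op (k (coeff Sig hα (φ i) q)) •
          Induced.unit h (p i)) = Induced.unit h q := by
        simp only [map_sum, map_smul, Induced.map_unit]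
        rw [← dualBasis_expand h b ψ hb q]
        have e (i : Fin n) := (dualBasis_expand h b ψ hb (α.hom.hom (p i))).symm
        simp only [e, Finset.smul_sum]
        rw [Finset.sum_comm]
        refine Finset.sum_congr rfl fun j _ => ?_
        rw [← hk', ← coeff_sum Sig hα p φ hpφ (ψ j) q]
        simp only [← mul_smul, ← op_mul, map_sum, map_mul, hk', Finset.sum_smul, Finset.op_sum]
      rw [← key, inv_map hα]
      have h3 : coeff Sig hα f q = ∑ i, of Sig (f (p i)) * coeff Sig hα (φ i) q := by
        let E : (P.obj →ₗ[Rᵐᵒᵖ] R) →+ UnivLoc Sig :=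
          AddMonoidHom.mk' (fun f => coeff Sig hα f q) (fun f f' => add_coeff Sig hα f f' q)
        change E f = _
        conv_lhs => rw [expand p φ hpφ f, map_sum]
        exact Finset.sum_congr rfl fun i _ => smul_coeff Sig hα _ _ _
      rw [h3]
      simp only [map_sum, map_mul, hk', map_smul, ev_unit, op_smul_eq_mul]

end UnivLoc

/-! Call a right `R`-module `N` local if every map `P → N` extends uniquely along every `α : P ⟶ Q`
in `Σ`. Both `M ⊗_R R_Σ` and `M_σ` are the universal local module under `M`, hence they are
isomorphic by a unique isomorphism under `M`.

For `M ⊗_R R_Σ`: local modules are the same as right `R_Σ`-modules. A module over `R_Σ` is local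
because `α ⊗ R_Σ` is invertible (`extendsUniquely_of_bijective_map`). Conversely, on a local module
the generator `[f, q]` sends `n` to the value at `q` of the extension of `p ↦ n f(p)` along `α`
(`UnivLoc.exists_module`). Maps of `R`-modules between local modules are automatically `R_Σ`-linear
(`UnivLoc.map_op_smul`), so the universal property of the induced module is the required one.

For `M_σ`: the maps along which all maps to a fixed `N` extend uniquely form a severe right Ore set
(`extendsUniquely_isSevereRightOre`), so a module local for `Σ` is local for `σ`. A map from `M` to
it therefore extends uniquely to each `M_s`, hence to `M_σ`. That `M_σ` is itself local
(`dirLim.extendsUniquely_of_projective`) uses that the limit is filtered and that `P` and `Q` are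
finitely generated projective, so that maps from them to `M_σ` come from some `M_s`. Pushouts then
give extensions, and the cokernel axiom gives their uniqueness. -/

/-! ## Pushouts and cokernels of finitely presented modules -/

namespace FPMod

variable {R : Type u} [Ring R]

/-- The linear map underlying a map of finitely presented modules. -/
abbrev lin {X Y : FPMod R} (f : X ⟶ Y) : X.obj →ₗ[Rᵐᵒᵖ] Y.obj := f.hom.hom

/-- A linear map between finitely presented modules as a map in `FPMod R`. -/
abbrev ofLin {X Y : FPMod R} (f : X.obj →ₗ[Rᵐᵒᵖ] Y.obj) : X ⟶ Y :=
  ObjectProperty.homMk (ModuleCat.ofHom f)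

theorem lin_injective {X Y : FPMod R} {f g : X ⟶ Y} (h : lin f = lin g) : f = g :=
  ObjectProperty.hom_ext _ (ModuleCat.hom_ext h)

theorem lin_comp {X Y Z : FPMod R} (f : X ⟶ Y) (g : Y ⟶ Z) : lin (f ≫ g) = lin g ∘ₗ lin f := rfl

theorem lin_zero {X Y : FPMod R} : lin (0 : X ⟶ Y) = 0 := rfl

instance finitePresentation (X : FPMod R) : Module.FinitePresentation Rᵐᵒᵖ X.obj := X.property

/-- The quotient of a finitely presented module by a finitely generated submodule. -/
abbrev quot (X : FPMod R) (K : Submodule Rᵐᵒᵖ X.obj) (hK : K.FG) : FPMod R :=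
  ⟨ModuleCat.of Rᵐᵒᵖ (X.obj ⧸ K),
    Module.finitePresentation_of_surjective K.mkQ K.mkQ_surjective (by rwa [K.ker_mkQ])⟩

/-- The product of two finitely presented modules. -/
abbrev prod (X Y : FPMod R) : FPMod R :=
  ⟨ModuleCat.of Rᵐᵒᵖ (X.obj × Y.obj),
    inferInstanceAs (Module.FinitePresentation Rᵐᵒᵖ (X.obj × Y.obj))⟩

theorem range_fg {X Y : FPMod R} (a : X ⟶ Y) : (LinearMap.range (lin a)).FG := by
  rw [LinearMap.range_eq_map]
  exact Module.Finite.fg_top.map _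

section Cokernel

variable {Y Z : FPMod R} (a : Y ⟶ Z)

/-- The cokernel of a map of finitely presented modules. -/
abbrev coker : FPMod R := quot Z (LinearMap.range (lin a)) (range_fg a)

/-- The projection onto the cokernel. -/
abbrev cokerπ : Z ⟶ coker a := ofLin (LinearMap.range (lin a)).mkQ

theorem comp_cokerπ : a ≫ cokerπ a = 0 :=
  lin_injective (LinearMap.range_mkQ_comp (lin a))

/-- `coker a` is the cokernel of `a` in the category of finitely presented modules. -/
def cokerIsColimit : IsColimit (CokernelCofork.ofπ (cokerπ a) (comp_cokerπ a)) :=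
  CokernelCofork.IsColimit.ofπ _ _
    (fun {_} k hk => ofLin ((LinearMap.range (lin a)).liftQ (lin k) (by
      rw [LinearMap.range_le_ker_iff, ← lin_comp, hk, lin_zero])))
    (fun {_} k hk => lin_injective (Submodule.liftQ_mkQ _ _ _))
    (fun {_} k hk m hm => lin_injective (Submodule.linearMap_qext _
      ((congrArg lin hm).trans (Submodule.liftQ_mkQ _ _ _).symm)))

variable {a}

/-- A cokernel in the category of finitely presented modules is a cokernel of modules. -/
theorem existsUnique_desc_cokernel {W : FPMod R} {t : Z ⟶ W} (h : a ≫ t = 0)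
    (ht : IsColimit (CokernelCofork.ofπ t h)) {N : Type w} [AddCommGroup N] [Module Rᵐᵒᵖ N]
    (k : Z.obj →ₗ[Rᵐᵒᵖ] N) (hk : k ∘ₗ lin a = 0) : ∃! l : W.obj →ₗ[Rᵐᵒᵖ] N, l ∘ₗ lin t = k := by
  let i : W ≅ coker a := ht.coconePointUniqueUpToIso (cokerIsColimit a)
  have hi : t ≫ i.hom = cokerπ a :=
    ht.comp_coconePointUniqueUpToIso_hom (cokerIsColimit a) WalkingParallelPair.one
  have hi' : cokerπ a ≫ i.inv = t := ((Iso.comp_inv_eq i).2 hi.symm)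
  have hk' : LinearMap.range (lin a) ≤ LinearMap.ker k := by rwa [LinearMap.range_le_ker_iff]
  refine ⟨(LinearMap.range (lin a)).liftQ k hk' ∘ₗ lin i.hom,
    ?_, fun l hl => ?_⟩
  · change (LinearMap.range (lin a)).liftQ k hk' ∘ₗ lin (t ≫ i.hom) = k
    rw [hi]
    exact Submodule.liftQ_mkQ _ _ _
  · have e : l = (l ∘ₗ lin i.inv) ∘ₗ lin i.hom := by
      change l = l ∘ₗ lin (i.hom ≫ i.inv)
      rw [i.hom_inv_id]
      rfl
    rw [e]
    congr 1
    refine Submodule.linearMap_qext _ ?_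
    rw [Submodule.liftQ_mkQ, ← hl]
    change l ∘ₗ lin (cokerπ a ≫ i.inv) = _
    rw [hi']

end Cokernel

section Pushout

variable {X Y Z : FPMod R} (s : X ⟶ Y) (a : X ⟶ Z)

/-- The map whose cokernel is the pushout. -/
abbrev pushoutRel : X ⟶ prod Y Z := ofLin ((lin s).prod (-lin a))

/-- The pushout of two maps of finitely presented modules. -/
abbrev push : FPMod R := coker (pushoutRel s a)

/-- The map to the pushout from the first module. -/
abbrev pushInl : Y ⟶ push s a :=
  ofLin (X := Y) (Y := prod Y Z) (LinearMap.inl _ _ _) ≫ cokerπ (pushoutRel s a)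

/-- The map to the pushout from the second module. -/
abbrev pushInr : Z ⟶ push s a :=
  ofLin (X := Z) (Y := prod Y Z) (LinearMap.inr _ _ _) ≫ cokerπ (pushoutRel s a)

theorem push_condition : s ≫ pushInl s a = a ≫ pushInr s a := by
  apply lin_injective
  ext x
  -- The difference of the two images of `x` is represented by `(s x, -a x)`, which is the relation
  -- coming from `x`.
  refine (Submodule.Quotient.eq _).2 ⟨x, ?_⟩
  refine Prod.ext ?_ ?_
  · exact (sub_zero _).symm
  · exact (zero_sub _).symm

variable {s a}

/-- The target is any module in any universe: it will be `M ⊗_R R_Σ` or `M_σ`, which need not be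
finitely presented, and the first lies in a larger universe than `R`. -/
theorem existsUnique_desc_push {N : Type w} [AddCommGroup N] [Module Rᵐᵒᵖ N]
    (g : Y.obj →ₗ[Rᵐᵒᵖ] N) (k : Z.obj →ₗ[Rᵐᵒᵖ] N) (h : g ∘ₗ lin s = k ∘ₗ lin a) :
    ∃! l : (push s a).obj →ₗ[Rᵐᵒᵖ] N, l ∘ₗ lin (pushInl s a) = g ∧ l ∘ₗ lin (pushInr s a) = k := by
  obtain ⟨l, hl, hu⟩ := existsUnique_desc_cokernel (comp_cokerπ (pushoutRel s a))
    (cokerIsColimit _) (g.coprod k) (by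
      ext x
      have := LinearMap.congr_fun h x
      simp only [LinearMap.comp_apply] at this
      change g (lin s x) + k (-lin a x) = 0
      rw [this, map_neg, add_neg_cancel])
  refine ⟨l, ⟨?_, ?_⟩, ?_⟩
  · rw [lin_comp, ← LinearMap.comp_assoc, hl]
    exact LinearMap.coprod_inl g k
  · rw [lin_comp, ← LinearMap.comp_assoc, hl]
    exact LinearMap.coprod_inr g k
  · rintro l' ⟨h1, h2⟩
    refine hu l' (LinearMap.prod_ext ?_ ?_)
    · exact h1.trans (LinearMap.coprod_inl g k).symm
    · exact h2.trans (LinearMap.coprod_inr g k).symm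

variable (s a)

theorem isPushout_push : IsPushout s a (pushInl s a) (pushInr s a) := by
  refine ⟨⟨push_condition s a⟩, ⟨PushoutCocone.IsColimit.mk _
    (fun c => ofLin (existsUnique_desc_push (lin c.inl) (lin c.inr)
      (congrArg lin c.condition)).exists.choose) (fun c => ?_) (fun c => ?_)
    (fun c m h1 h2 => ?_)⟩⟩
  · exact lin_injective (existsUnique_desc_push (lin c.inl) (lin c.inr)
      (congrArg lin c.condition)).exists.choose_spec.1
  · exact lin_injective (existsUnique_desc_push (lin c.inl) (lin c.inr)
      (congrArg lin c.condition)).exists.choose_spec.2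
  · have H := existsUnique_desc_push (lin c.inl) (lin c.inr) (congrArg lin c.condition)
    exact lin_injective (H.unique ⟨congrArg lin h1, congrArg lin h2⟩ H.exists.choose_spec)

variable {s a}

/-- A pushout in the category of finitely presented modules is a pushout of modules. -/
theorem existsUnique_desc_pushout {W : FPMod R} {a' : Y ⟶ W} {s' : Z ⟶ W}
    (hp : IsPushout s a a' s') {N : Type w} [AddCommGroup N] [Module Rᵐᵒᵖ N]
    (g : Y.obj →ₗ[Rᵐᵒᵖ] N) (k : Z.obj →ₗ[Rᵐᵒᵖ] N) (h : g ∘ₗ lin s = k ∘ₗ lin a) :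
    ∃! l : W.obj →ₗ[Rᵐᵒᵖ] N, l ∘ₗ lin a' = g ∧ l ∘ₗ lin s' = k := by
  let i := hp.isoIsPushout _ _ (isPushout_push s a)
  have hl : a' ≫ i.hom = pushInl s a := hp.inl_isoIsPushout_hom _ _ _
  have hr : s' ≫ i.hom = pushInr s a := hp.inr_isoIsPushout_hom _ _ _
  have hl' : pushInl s a ≫ i.inv = a' := by
    rw [← hl, Category.assoc, i.hom_inv_id, Category.comp_id]
  have hr' : pushInr s a ≫ i.inv = s' := by
    rw [← hr, Category.assoc, i.hom_inv_id, Category.comp_id]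
  obtain ⟨l, ⟨h1, h2⟩, hu⟩ := existsUnique_desc_push g k h
  refine ⟨l ∘ₗ lin i.hom, ⟨?_, ?_⟩, ?_⟩
  · rw [LinearMap.comp_assoc, ← lin_comp, hl, h1]
  · rw [LinearMap.comp_assoc, ← lin_comp, hr, h2]
  · rintro l' ⟨h1', h2'⟩
    rw [← hu (l' ∘ₗ lin i.inv) ⟨by rw [LinearMap.comp_assoc, ← lin_comp, hl', h1'],
      by rw [LinearMap.comp_assoc, ← lin_comp, hr', h2']⟩, LinearMap.comp_assoc, ← lin_comp,
      i.hom_inv_id]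
    rfl

end Pushout

end FPMod

/-! ## Local modules -/

section Local

variable {R : Type u} [Ring R] (N : Type w) [AddCommGroup N] [Module Rᵐᵒᵖ N]

/-- The maps `s` for which every map to `N` extends uniquely along `s`. -/
def extendsUniquely : MorphismProperty (FPMod R) := fun X Y s =>
  Function.Bijective fun g : Y.obj →ₗ[Rᵐᵒᵖ] N => (g ∘ₗ FPMod.lin s : X.obj →ₗ[Rᵐᵒᵖ] N)

/-- This carries locality from `Σ` to all of `σ`. For a pushout, extending along `s'` amounts to
extending along `s`. For a cokernel, uniqueness along `s` forces every map to `N` to vanish on the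
image of `a`. -/
theorem extendsUniquely_isSevereRightOre : IsSevereRightOre (extendsUniquely (R := R) N) where
  iso_mem X Y f _ := by
    refine Function.bijective_iff_has_inverse.2
      ⟨fun g => g ∘ₗ FPMod.lin (inv f), fun g => ?_, fun g => ?_⟩
    · change g ∘ₗ FPMod.lin (inv f ≫ f) = g
      rw [IsIso.inv_hom_id]
      rfl
    · change g ∘ₗ FPMod.lin (f ≫ inv f) = g
      rw [IsIso.hom_inv_id]
      rfl
  comp_mem _ _ _ s t hs ht := hs.comp ht
  pushout_mem X Y Z W s a a' s' hp hs := by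
    have w : FPMod.lin a' ∘ₗ FPMod.lin s = FPMod.lin s' ∘ₗ FPMod.lin a := congrArg FPMod.lin hp.w
    refine ⟨fun l l' h => ?_, fun k => ?_⟩
    · have h' : l ∘ₗ FPMod.lin s' = l' ∘ₗ FPMod.lin s' := h
      -- A map out of the pushout is determined by both legs; agreement on the leg `a'` follows from
      -- uniqueness along `s`.
      have e : l ∘ₗ FPMod.lin a' = l' ∘ₗ FPMod.lin a' := hs.1 <| by
        change (l ∘ₗ FPMod.lin a') ∘ₗ FPMod.lin s = (l' ∘ₗ FPMod.lin a') ∘ₗ FPMod.lin s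
        rw [LinearMap.comp_assoc, w, ← LinearMap.comp_assoc, h', LinearMap.comp_assoc, ← w]
        rfl
      exact (FPMod.existsUnique_desc_pushout hp (l' ∘ₗ FPMod.lin a') (l' ∘ₗ FPMod.lin s') (by
        rw [LinearMap.comp_assoc, w]; rfl)).unique ⟨e, h'⟩ ⟨rfl, rfl⟩
    · obtain ⟨g, hg⟩ := hs.2 (k ∘ₗ FPMod.lin a)
      obtain ⟨l, hl⟩ := (FPMod.existsUnique_desc_pushout hp g k hg).exists
      exact ⟨l, hl.2⟩
  cokernel_mem X Y Z W s a t h hs hsa ht := by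
    obtain ⟨ht⟩ := ht
    refine ⟨fun l l' e => ?_, fun k => ?_⟩
    · refine (FPMod.existsUnique_desc_cokernel h ht (l' ∘ₗ FPMod.lin t) ?_).unique e rfl
      rw [LinearMap.comp_assoc, ← FPMod.lin_comp, h]
      exact LinearMap.comp_zero _
    · refine (FPMod.existsUnique_desc_cokernel h ht k (hs.1 ?_)).exists
      change (k ∘ₗ FPMod.lin a) ∘ₗ FPMod.lin s = 0 ∘ₗ FPMod.lin s
      rw [LinearMap.comp_assoc, ← FPMod.lin_comp, hsa, LinearMap.zero_comp]
      exact LinearMap.comp_zero _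

variable {N}

theorem severeClosure_le_extendsUniquely {Sig : MorphismProperty (FPMod R)}
    (hN : Sig ≤ extendsUniquely N) : severeClosure Sig ≤ extendsUniquely N :=
  fun _ _ _ hs => hs _ (extendsUniquely_isSevereRightOre N) hN

end Local
/-! ## Local modules are modules over the universal localisation -/

section Restrict

variable {R : Type u} {S : Type w} [Ring R] [Ring S]

/-- The right `S`-module `M ⊗_R S` as a right `R`-module. -/
instance Induced.baseModule (h : R →+* S) (M : Type w') [AddCommGroup M] [Module Rᵐᵒᵖ M] :
    Module Rᵐᵒᵖ (Induced h M) :=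
  Module.compHom _ h.op

theorem Induced.op_smul_def (h : R →+* S) {M : Type w'} [AddCommGroup M] [Module Rᵐᵒᵖ M] (r : R)
    (x : Induced h M) : op r • x = op (h r) • x := rfl

/-- Maps to a right `S`-module extend uniquely along the maps that are inverted by `R → S`. -/
theorem extendsUniquely_of_bijective_map (h : R →+* S) {A : Type w'} [AddCommGroup A]
    [Module Rᵐᵒᵖ A] [Module Sᵐᵒᵖ A] (hA : ∀ (r : R) (a : A), op r • a = op (h r) • a)
    {P Q : FPMod R} {α : P ⟶ Q} (hα : Function.Bijective (Induced.map h (FPMod.lin α))) :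
    extendsUniquely A α := by
  let ext {M : FPMod R} (f : M.obj →ₗ[Rᵐᵒᵖ] A) : Induced h M.obj →ₗ[Sᵐᵒᵖ] A :=
    Induced.lift h f.toAddMonoidHom fun m r => (f.map_smul _ _).trans (hA _ _)
  have ext_unit {M : FPMod R} (f : M.obj →ₗ[Rᵐᵒᵖ] A) (m : M.obj) :
      ext f (Induced.unit h m) = f m := Induced.lift_unit h _ _ m
  refine ⟨fun f g e => ?_, fun f => ?_⟩
  · have e' : ext f ∘ₗ Induced.map h (FPMod.lin α) = ext g ∘ₗ Induced.map h (FPMod.lin α) :=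
      Induced.hom_ext h fun p => by
        simp only [LinearMap.comp_apply, Induced.map_unit, ext_unit]
        exact LinearMap.congr_fun e p
    ext q
    -- While `q` need not come from `P`, the element `q ⊗ 1` does come from `P ⊗_R S`.
    obtain ⟨y, hy⟩ := hα.2 (Induced.unit h q)
    rw [← ext_unit f, ← ext_unit g, ← hy]
    exact LinearMap.congr_fun e' y
  · let β := LinearEquiv.ofBijective (Induced.map h (FPMod.lin α)) hα
    refine ⟨
      { toFun := fun q => ext f (β.symm (Induced.unit h q))
        map_add' := fun q q' => by rw [map_add, map_add, map_add]
        map_smul' := fun c q => ?_ }, ?_⟩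
    · rw [← op_unop c, Induced.unit_smul, map_smul, map_smul, RingHom.id_apply, hA]
    · ext p
      change ext f (β.symm (Induced.unit h (FPMod.lin α p))) = f p
      rw [← Induced.map_unit, ← ext_unit f p]
      exact congrArg _ (β.symm_apply_apply _)

end Restrict

namespace UnivLoc

variable {R : Type u} [Ring R] {Sig : MorphismProperty (FPMod R)}

/-! ### Automatic linearity over `R_Σ` -/

section Uniqueness

variable {A : Type w} {B : Type w'} [AddCommGroup A] [AddCommGroup B] [Module Rᵐᵒᵖ A]
  [Module Rᵐᵒᵖ B] [Module (UnivLoc Sig)ᵐᵒᵖ A] [Module (UnivLoc Sig)ᵐᵒᵖ B]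

/-- An `R`-linear map between right modules over `R_Σ` is `R_Σ`-linear. -/
theorem map_op_smul (hA : ∀ (r : R) (a : A), op r • a = op (of Sig r) • a)
    (hB : ∀ (r : R) (b : B), op r • b = op (of Sig r) • b) (hloc : Sig ≤ extendsUniquely B)
    (g : A →ₗ[Rᵐᵒᵖ] B) (x : UnivLoc Sig) (a : A) : g (op x • a) = op x • g a := by
  obtain ⟨x, rfl⟩ : ∃ y, mk Sig y = x := RingQuot.mkRingHom_surjective _ x
  induction x using FreeAlgebra.induction generalizing a with
  | grade0 n =>
    have : mk Sig (algebraMap ℤ _ n) = (n : UnivLoc Sig) := by simp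
    rw [this, ← zsmul_one, op_smul, op_one, smul_assoc, smul_assoc, one_smul, one_smul, map_zsmul]
  | grade1 c =>
    rcases c with r | ⟨P, Q, α, hα, f, q⟩
    · change g (op (of Sig r) • a) = op (of Sig r) • g a
      rw [← hA, ← hB, map_smul]
    -- The action of `[f, q]` is viewed as a function of `q`. Since `[f, α p] = f p`, both `g ∘ FA`
    -- and `FB` restrict along `α` to `p ↦ g(a) f(p)`, and such a map extends to `Q` in only one
    -- way.
    · let FA : Q.obj →ₗ[Rᵐᵒᵖ] A :=
        { toFun := fun q => op (coeff Sig hα f q) • a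
          map_add' := fun q q' => by rw [map_add, MulOpposite.op_add, add_smul]
          map_smul' := fun c q => by
            rw [← op_unop c, coeff_smul, op_mul, mul_smul, RingHom.id_apply, hA] }
      let FB : Q.obj →ₗ[Rᵐᵒᵖ] B :=
        { toFun := fun q => op (coeff Sig hα f q) • g a
          map_add' := fun q q' => by rw [map_add, MulOpposite.op_add, add_smul]
          map_smul' := fun c q => by
            rw [← op_unop c, coeff_smul, op_mul, mul_smul, RingHom.id_apply, hB] }
      have : g ∘ₗ FA = FB := (hloc α hα).1 <| by
        ext p
        change g (op (coeff Sig hα f (α.hom.hom p)) • a) = op (coeff Sig hα f (α.hom.hom p)) • g a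
        rw [coeff_map, ← hA, ← hB, map_smul]
      exact LinearMap.congr_fun this q
  | mul x y hx hy => rw [map_mul, op_mul, mul_smul, mul_smul, hy, hx]
  | add x y hx hy => rw [map_add, MulOpposite.op_add, add_smul, add_smul, map_add, hx, hy]

end Uniqueness

/-! ### The action of `R_Σ` on a local module -/

section Action

variable {N : Type w} [AddCommGroup N] [Module Rᵐᵒᵖ N]

/-- The map `R → N` that sends `r` to `n r`. -/
def orbit (n : N) : R →ₗ[Rᵐᵒᵖ] N where
  toFun r := op r • n
  map_add' r r' := by rw [MulOpposite.op_add, add_smul]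
  map_smul' c r := by rw [← op_unop c, op_smul_eq_mul, op_mul, mul_smul, RingHom.id_apply]

theorem orbit_apply (n : N) (r : R) : orbit n r = op r • n := rfl

theorem orbit_add (n n' : N) : (orbit (n + n') : R →ₗ[Rᵐᵒᵖ] N) = orbit n + orbit n' :=
  LinearMap.ext fun _ => smul_add _ _ _

/-- The unique extension of `g` along `α`. -/
noncomputable def extend {P Q : FPMod R} {α : P ⟶ Q} (hα : extendsUniquely N α)
    (g : P.obj →ₗ[Rᵐᵒᵖ] N) : Q.obj →ₗ[Rᵐᵒᵖ] N :=
  (hα.2 g).choose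

theorem extend_comp {P Q : FPMod R} {α : P ⟶ Q} (hα : extendsUniquely N α)
    (g : P.obj →ₗ[Rᵐᵒᵖ] N) : extend hα g ∘ₗ FPMod.lin α = g :=
  (hα.2 g).choose_spec

theorem extend_apply {P Q : FPMod R} {α : P ⟶ Q} (hα : extendsUniquely N α)
    (g : P.obj →ₗ[Rᵐᵒᵖ] N) (p : P.obj) : extend hα g (FPMod.lin α p) = g p :=
  LinearMap.congr_fun (extend_comp hα g) p

theorem extend_eq {P Q : FPMod R} {α : P ⟶ Q} (hα : extendsUniquely N α)
    {g : P.obj →ₗ[Rᵐᵒᵖ] N} {k : Q.obj →ₗ[Rᵐᵒᵖ] N} (h : k ∘ₗ FPMod.lin α = g) :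
    extend hα g = k :=
  hα.1 ((extend_comp hα g).trans h.symm)

theorem extend_add {P Q : FPMod R} {α : P ⟶ Q} (hα : extendsUniquely N α)
    (g g' : P.obj →ₗ[Rᵐᵒᵖ] N) : extend hα (g + g') = extend hα g + extend hα g' :=
  extend_eq hα (by rw [LinearMap.add_comp, extend_comp, extend_comp])

theorem extend_sum {P Q : FPMod R} {α : P ⟶ Q} (hα : extendsUniquely N α) {ι : Type*}
    (t : Finset ι) (g : ι → (P.obj →ₗ[Rᵐᵒᵖ] N)) :
    extend hα (∑ i ∈ t, g i) = ∑ i ∈ t, extend hα (g i) :=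
  map_sum (AddMonoidHom.mk' (extend hα) (extend_add hα)) _ _

variable (hN : Sig ≤ extendsUniquely N)

/-- The action of the generators of `R_Σ` on a local module. -/
noncomputable def genAction : R ⊕ Gen Sig → (AddMonoid.End N)ᵐᵒᵖ :=
  Sum.elim (fun r => op (AddMonoidHom.mk' (fun n => op r • n) (fun n n' => smul_add _ n n')))
    -- As `[f, q]` stands for `f (α⁻¹ q)`, its action on `n` must be the extension of `p ↦ n f(p)`
    -- along `α`, taken at `q`.
    fun c => op (AddMonoidHom.mk' (fun n => extend (hN c.α c.mem) (orbit n ∘ₗ c.f) c.q)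
      fun n n' => by rw [orbit_add, LinearMap.add_comp, extend_add, LinearMap.add_apply])

/-- The action of the free ring on a local module. -/
noncomputable def freeAction : FreeAlgebra ℤ (R ⊕ Gen Sig) →+* (AddMonoid.End N)ᵐᵒᵖ :=
  (FreeAlgebra.lift ℤ (genAction hN)).toRingHom

theorem freeAction_r (x : R) (n : N) : (freeAction hN (r Sig x)).unop n = op x • n := by
  change (FreeAlgebra.lift ℤ (genAction hN) (FreeAlgebra.ι ℤ _)).unop n = _
  rw [FreeAlgebra.lift_ι_apply]
  rfl

theorem freeAction_g {P Q : FPMod R} {α : P ⟶ Q} (hα : Sig α) (f : P.obj →ₗ[Rᵐᵒᵖ] R) (q : Q.obj)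
    (n : N) : (freeAction hN (g hα f q)).unop n = extend (hN α hα) (orbit n ∘ₗ f) q := by
  change (FreeAlgebra.lift ℤ (genAction hN) (FreeAlgebra.ι ℤ _)).unop n = _
  rw [FreeAlgebra.lift_ι_apply]
  rfl

/-- Taking values in the opposite of the endomorphism ring makes the factors of a product act from
left to right, as on a right module. -/
theorem freeAction_mul (x y : FreeAlgebra ℤ (R ⊕ Gen Sig)) (n : N) :
    (freeAction hN (x * y)).unop n = (freeAction hN y).unop ((freeAction hN x).unop n) := by
  rw [map_mul]
  rfl

theorem freeAction_add (x y : FreeAlgebra ℤ (R ⊕ Gen Sig)) (n : N) :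
    (freeAction hN (x + y)).unop n = (freeAction hN x).unop n + (freeAction hN y).unop n := by
  rw [map_add]
  rfl

theorem freeAction_sum {ι : Type*} (t : Finset ι) (x : ι → FreeAlgebra ℤ (R ⊕ Gen Sig)) (n : N) :
    (freeAction hN (∑ i ∈ t, x i)).unop n = ∑ i ∈ t, (freeAction hN (x i)).unop n :=
  map_sum (AddMonoidHom.mk' (fun y => (freeAction hN y).unop n)
    fun y z => freeAction_add hN y z n) _ _

theorem freeAction_rel {x y : FreeAlgebra ℤ (R ⊕ Gen Sig)} (hxy : Rel Sig x y) :
    freeAction hN x = freeAction hN y := by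
  suffices H : ∀ n : N, (freeAction hN x).unop n = (freeAction hN y).unop n from
    unop_injective (AddMonoidHom.ext H)
  intro n
  induction hxy with
  | one =>
    rw [freeAction_r, map_one, op_one, one_smul]
    rfl
  | add x y => simp only [freeAction_add, freeAction_r, MulOpposite.op_add, add_smul]
  | mul x y => simp only [freeAction_mul, freeAction_r, op_mul, mul_smul]
  | add_left hα f f' q =>
    simp only [freeAction_add, freeAction_g, LinearMap.comp_add, extend_add, LinearMap.add_apply]
  | add_right hα f q q' =>
    rw [freeAction_add]
    simp only [freeAction_g, map_add]
  | smul_left hα x f q =>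
    simp only [freeAction_mul, freeAction_g, freeAction_r]
    congr 2
    ext p
    simp [orbit_apply, mul_smul]
  | smul_right hα f q x => simp only [freeAction_mul, freeAction_g, freeAction_r, map_smul]
  | inv_left hα f p =>
    rw [freeAction_g, freeAction_r]
    exact extend_apply _ _ _
  | @inv_right P Q α hα n' p φ hpφ k q =>
    simp only [freeAction_sum, freeAction_mul, freeAction_g, freeAction_r]
    -- The sum becomes one extension along `α`, that of `x ↦ ∑ i, n k(α p_i) φ_i(x)`. By the dual
    -- basis this map is `x ↦ n k(α x)`, which `orbit n ∘ k` visibly extends.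
    rw [← LinearMap.sum_apply, ← extend_sum]
    change _ = (orbit n ∘ₗ k) q
    congr 1
    refine extend_eq _ ?_
    ext x
    have hx : k (FPMod.lin α x) = ∑ i, k (FPMod.lin α (p i)) * φ i x := by
      conv_lhs => rw [← hpφ x, map_sum, map_sum]
      simp
    simp only [LinearMap.comp_apply, LinearMap.sum_apply, orbit_apply, hx, Finset.op_sum,
      Finset.sum_smul, op_mul, mul_smul]

end Action

section Module

variable {N : Type w} [AddCommGroup N] [Module Rᵐᵒᵖ N]

/-- A local module is a module over `R_Σ`. -/
theorem exists_module (hN : Sig ≤ extendsUniquely N) : ∃ _ : Module (UnivLoc Sig)ᵐᵒᵖ N,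
    ∀ (r : R) (n : N), op r • n = op (of Sig r) • n := by
  let k : UnivLoc Sig →+* (AddMonoid.End N)ᵐᵒᵖ :=
    RingQuot.lift ⟨freeAction hN, fun _ _ h => freeAction_rel hN h⟩
  have hk (r : R) : k (of Sig r) = freeAction hN (UnivLoc.r Sig r) :=
    RingQuot.lift_mkRingHom_apply _ _ _
  let k' : (UnivLoc Sig)ᵐᵒᵖ →+* AddMonoid.End N :=
    (RingEquiv.opOp (AddMonoid.End N)).symm.toRingHom.comp k.op
  refine ⟨Module.compHom N k', fun r n => ?_⟩
  change _ = (k (of Sig r)).unop n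
  rw [hk, freeAction_r]

/-- A map from `M` to a local module extends to `M ⊗_R R_Σ`. -/
theorem exists_desc_induced (hN : Sig ≤ extendsUniquely N) {M : Type w'} [AddCommGroup M]
    [Module Rᵐᵒᵖ M] (f : M →ₗ[Rᵐᵒᵖ] N) :
    ∃ F : Induced (of Sig) M →ₗ[Rᵐᵒᵖ] N, ∀ m, F (Induced.unit (of Sig) m) = f m := by
  obtain ⟨inst, hinst⟩ := exists_module hN
  have hf : ∀ (m : M) (r : R), f.toAddMonoidHom (op r • m) = op (of Sig r) • f.toAddMonoidHom m :=
    fun m r => (f.map_smul _ _).trans (hinst _ _)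
  let F := Induced.lift (of Sig) f.toAddMonoidHom hf
  refine ⟨{ F with map_smul' := fun c x => ?_ }, fun m => Induced.lift_unit _ _ hf m⟩
  rw [← op_unop c, RingHom.id_apply, hinst, Induced.op_smul_def]
  exact F.map_smul _ _

end Module

/-- An `R`-linear map from `M ⊗_R R_Σ` to itself that fixes the elements `m ⊗ 1` is the identity. -/
theorem induced_eq_id (hSig : InvertsMaps (of Sig) Sig) {M : Type w} [AddCommGroup M]
    [Module Rᵐᵒᵖ M] (g : Induced (of Sig) M →ₗ[Rᵐᵒᵖ] Induced (of Sig) M)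
    (hg : ∀ m, g (Induced.unit (of Sig) m) = Induced.unit (of Sig) m)
    (x : Induced (of Sig) M) : g x = x := by
  induction x using Induced.induction_on with
  | unit m s =>
    -- The target is a module over `R_Σ`, hence local, so `g` is `R_Σ`-linear and is determined on
    -- `(m ⊗ 1) s` by its value on `m ⊗ 1`.
    rw [map_op_smul (fun r a => Induced.op_smul_def _ r a) (fun r a => Induced.op_smul_def _ r a)
      (fun P Q α hα => extendsUniquely_of_bijective_map (of Sig)
        (fun r a => Induced.op_smul_def _ r a) (hSig α hα)), hg]
  | add x y hx hy => rw [map_add, hx, hy]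

end UnivLoc
/-! ## The direct limit `M_σ` -/

/-- The index category of the direct limit `M_σ` is filtered. -/
theorem IsSevereRightOre.isFiltered_under {R : Type u} [Ring R] {σ : MorphismProperty (FPMod R)}
    [σ.IsMultiplicative] (hσ : IsSevereRightOre σ) (M : FPMod R) : IsFiltered (σ.Under σ M) where
  nonempty := ⟨MorphismProperty.Under.mk σ (𝟙 M) (σ.id_mem M)⟩
  cocone_objs S U := by
    -- Each leg of this pushout square is the pushout of the opposite map in `σ`, so both legs lie
    -- in `σ`.
    have hp := FPMod.isPushout_push S.hom U.hom
    have hr : σ (FPMod.pushInr S.hom U.hom) := hσ.pushout_mem _ _ _ _ hp S.prop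
    have hl : σ (FPMod.pushInl S.hom U.hom) := hσ.pushout_mem _ _ _ _ hp.flip U.prop
    exact ⟨MorphismProperty.Under.mk σ (S.hom ≫ FPMod.pushInl S.hom U.hom)
        (σ.comp_mem _ _ S.prop hl),
      MorphismProperty.Under.Hom.mk (CategoryTheory.Under.homMk (FPMod.pushInl S.hom U.hom)) hl,
      MorphismProperty.Under.Hom.mk
        (CategoryTheory.Under.homMk (FPMod.pushInr S.hom U.hom) hp.w.symm) hr, trivial⟩
  cocone_maps S U t t' := by
    let f : S.right ⟶ U.right := t.right
    let f' : S.right ⟶ U.right := t'.right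
    -- Two parallel morphisms agree after composition with `S.hom`, so the cokernel axiom puts their
    -- coequaliser, the cokernel of `f - f'`, in `σ`.
    have h : S.hom ≫ (f - f') = 0 := by
      rw [Preadditive.comp_sub, sub_eq_zero]
      exact (MorphismProperty.Under.w t).trans (MorphismProperty.Under.w t').symm
    have hc : σ (FPMod.cokerπ (f - f')) := hσ.cokernel_mem S.hom (f - f') _
      (FPMod.comp_cokerπ _) S.prop h ⟨FPMod.cokerIsColimit _⟩
    refine ⟨MorphismProperty.Under.mk σ (U.hom ≫ FPMod.cokerπ (f - f'))
        (σ.comp_mem _ _ U.prop hc),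
      MorphismProperty.Under.Hom.mk (CategoryTheory.Under.homMk (FPMod.cokerπ (f - f'))) hc, ?_⟩
    apply MorphismProperty.Under.Hom.ext
    have := FPMod.comp_cokerπ (f - f')
    rw [Preadditive.sub_comp, sub_eq_zero] at this
    exact this

/-- Two maps in `σ` that begin at `M` can be completed to a square in `σ`. -/
theorem IsSevereRightOre.exists_common {R : Type u} [Ring R]
    {σ : MorphismProperty (FPMod R)} (hσ : IsSevereRightOre σ) {M N K : FPMod R} {s : M ⟶ N}
    (hs : σ s)
    {u : M ⟶ K} (hu : σ u) :
    ∃ (L : FPMod R) (t : N ⟶ L) (t' : K ⟶ L), σ t ∧ σ t' ∧ s ≫ t = u ≫ t' := by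
  have hp := FPMod.isPushout_push s u
  exact ⟨_, _, _, hσ.pushout_mem _ _ _ _ hp.flip hu, hσ.pushout_mem _ _ _ _ hp hs, hp.w⟩

/-- A directed family of submodules that covers a finitely generated module contains the whole
module. -/
theorem Submodule.exists_eq_top_of_directed {A : Type*} {P : Type*} [Ring A]
    [AddCommGroup P] [Module A P] [Module.Finite A P] {ι : Type*} [Nonempty ι]
    (W : ι → Submodule A P) (hd : Directed (· ≤ ·) W) (hW : ∀ p, ∃ i, p ∈ W i) :
    ∃ i, W i = ⊤ := by
  obtain ⟨t, ht⟩ := (Module.Finite.fg_top : (⊤ : Submodule A P).FG)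
  choose i hi using hW
  classical
  obtain ⟨j, hj⟩ := hd.finset_le (t.image i)
  refine ⟨j, top_unique ?_⟩
  rw [← ht, Submodule.span_le]
  exact fun p hp => hj _ (Finset.mem_image_of_mem i hp) (hi p)

namespace dirLim

variable {R : Type u} [Ring R] {σ : MorphismProperty (FPMod R)} [σ.IsMultiplicative]
  [σ.RespectsIso] {M : FPMod R}

/-- The canonical map `M_s → M_σ` as a linear map. -/
noncomputable abbrev ιLin {N : FPMod R} (s : M ⟶ N) (hs : σ s) :
    N.obj →ₗ[Rᵐᵒᵖ] dirLim σ M :=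
  (dirLim.ι σ s hs).hom

theorem ιLin_comp {N K : FPMod R} (s : M ⟶ N) (hs : σ s) (t : N ⟶ K) (ht : σ t) :
    ιLin (s ≫ t) (σ.comp_mem _ _ hs ht) ∘ₗ FPMod.lin t = ιLin s hs := by
  let f : MorphismProperty.Under.mk σ s hs ⟶
      MorphismProperty.Under.mk σ (s ≫ t) (σ.comp_mem _ _ hs ht) :=
    MorphismProperty.Under.Hom.mk (CategoryTheory.Under.homMk t) ht
  exact congrArg ModuleCat.Hom.hom (colimit.w (limitSystem σ M) f)

/-- The index category is large but essentially small, so the claim reduces to a small filtered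
model. It gives the description of `M_σ` by representatives in the terms `M_s`. -/
theorem preservesColimit [IsFiltered (σ.Under σ M)] :
    PreservesColimitsOfShape (σ.Under σ M) (forget (ModuleCat.{u} Rᵐᵒᵖ)) := by
  have : IsFiltered (SmallModel.{u} (σ.Under σ M)) :=
    IsFiltered.of_equivalence (equivSmallModel.{u} (σ.Under σ M))
  exact preservesColimitsOfShape_of_equiv (equivSmallModel.{u} (σ.Under σ M)).symm _

theorem exists_rep (hσ : IsSevereRightOre σ) (y : dirLim σ M) :
    ∃ (N : FPMod R) (s : M ⟶ N) (hs : σ s) (x : N.obj), ιLin s hs x = y := by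
  have := hσ.isFiltered_under M
  have := preservesColimit (σ := σ) (M := M)
  obtain ⟨S, x, hx⟩ := Concrete.colimit_exists_rep (limitSystem σ M) y
  exact ⟨S.right, S.hom, S.prop, x, hx⟩

theorem exists_of_ιLin_eq (hσ : IsSevereRightOre σ) {N K : FPMod R} {s : M ⟶ N} {hs : σ s}
    {u : M ⟶ K} {hu : σ u} {x : N.obj} {y : K.obj} (h : ιLin s hs x = ιLin u hu y) :
    ∃ (L : FPMod R) (t : N ⟶ L) (t' : K ⟶ L), σ t ∧ σ t' ∧ s ≫ t = u ≫ t' ∧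
      FPMod.lin t x = FPMod.lin t' y := by
  have := hσ.isFiltered_under M
  have := preservesColimit (σ := σ) (M := M)
  obtain ⟨L, t, t', e⟩ := Concrete.colimit_exists_of_rep_eq (limitSystem σ M)
    (i := MorphismProperty.Under.mk σ s hs) (j := MorphismProperty.Under.mk σ u hu) x y h
  exact ⟨L.right, t.right, t'.right, t.prop_hom_right, t'.prop_hom_right,
    (MorphismProperty.Under.w t).trans (MorphismProperty.Under.w t').symm, e⟩

theorem exists_rep₂ (hσ : IsSevereRightOre σ) (y y' : dirLim σ M) :
    ∃ (N : FPMod R) (s : M ⟶ N) (hs : σ s) (x x' : N.obj), ιLin s hs x = y ∧ ιLin s hs x' = y' := by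
  obtain ⟨N, s, hs, x, rfl⟩ := exists_rep hσ y
  obtain ⟨K, u, hu, x', rfl⟩ := exists_rep hσ y'
  obtain ⟨L, t, t', ht, ht', e⟩ := hσ.exists_common hs hu
  refine ⟨L, s ≫ t, σ.comp_mem _ _ hs ht, FPMod.lin t x, FPMod.lin t' x',
    LinearMap.congr_fun (ιLin_comp s hs t ht) x, ?_⟩
  have := LinearMap.congr_fun (ιLin_comp u hu t' ht') x'
  simp only [← e] at this
  exact this

/-- Compatible maps on the terms of the system induce a map on the direct limit. -/
theorem exists_desc (hσ : IsSevereRightOre σ) {N : Type w} [AddCommGroup N] [Module Rᵐᵒᵖ N]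
    (f : ∀ {K : FPMod R} (s : M ⟶ K), σ s → (K.obj →ₗ[Rᵐᵒᵖ] N))
    (hf : ∀ {K L : FPMod R} (s : M ⟶ K) (hs : σ s) (t : K ⟶ L) (ht : σ t),
      f (s ≫ t) (σ.comp_mem _ _ hs ht) ∘ₗ FPMod.lin t = f s hs) :
    ∃ F : dirLim σ M →ₗ[Rᵐᵒᵖ] N, ∀ {K : FPMod R} (s : M ⟶ K) (hs : σ s),
      F ∘ₗ ιLin s hs = f s hs := by
  -- The colimit property in `ModuleCat.{u}` does not reach targets in another universe, so the map
  -- is defined through chosen representatives. Two representatives of one element agree in a later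
  -- term, where `hf` compares their values.
  choose K s hs x hx using exists_rep (M := M) hσ
  let F (y : dirLim σ M) : N := f (s y) (hs y) (x y)
  have hF {L : FPMod R} (u : M ⟶ L) (hu : σ u) (z : L.obj) : F (ιLin u hu z) = f u hu z := by
    obtain ⟨L', t, t', ht, ht', e, e'⟩ := exists_of_ιLin_eq hσ (hx (ιLin u hu z))
    have h1 := LinearMap.congr_fun (hf _ (hs (ιLin u hu z)) t ht) (x (ιLin u hu z))
    have h2 := LinearMap.congr_fun (hf u hu t' ht') z
    simp only [LinearMap.comp_apply] at h1 h2
    simp only [e, e'] at h1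
    exact h1.symm.trans h2
  refine ⟨{ toFun := F, map_add' := fun y y' => ?_, map_smul' := fun c y => ?_ },
    fun u hu => LinearMap.ext (hF u hu)⟩
  · obtain ⟨L, u, hu, z, z', rfl, rfl⟩ := exists_rep₂ hσ y y'
    rw [← map_add, hF, hF, hF, map_add]
  · obtain ⟨L, u, hu, z, rfl⟩ := exists_rep hσ y
    rw [← map_smul, hF, hF, map_smul, RingHom.id_apply]

/-! ### Locality of `M_σ` -/

/-- A map from a finitely generated projective module to the direct limit factors through a term
of the system. -/
theorem exists_factor (hσ : IsSevereRightOre σ) {P : FPMod R} [Module.Projective Rᵐᵒᵖ P.obj]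
    (f : P.obj →ₗ[Rᵐᵒᵖ] dirLim σ M) :
    ∃ (N : FPMod R) (s : M ⟶ N) (hs : σ s) (g : P.obj →ₗ[Rᵐᵒᵖ] N.obj), ιLin s hs ∘ₗ g = f := by
  let J := Σ N : FPMod R, {s : M ⟶ N // σ s}
  have : Nonempty J := ⟨⟨M, 𝟙 M, σ.id_mem M⟩⟩
  -- The preimages in `P` of the images of the terms are directed and cover `P`, so one of them is
  -- all of `P`. Projectivity then lifts `f` through the term onto its image.
  obtain ⟨⟨N, s, hs⟩, h⟩ := Submodule.exists_eq_top_of_directed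
    (fun j : J => (LinearMap.range (ιLin j.2.1 j.2.2)).comap f) (by
      rintro ⟨N, s, hs⟩ ⟨K, u, hu⟩
      obtain ⟨L, t, t', ht, ht', e⟩ := hσ.exists_common hs hu
      refine ⟨⟨L, s ≫ t, σ.comp_mem _ _ hs ht⟩, Submodule.comap_mono ?_, Submodule.comap_mono ?_⟩
      · rw [← ιLin_comp s hs t ht]
        exact LinearMap.range_comp_le_range _ _
      · simp only [e]
        rw [← ιLin_comp u hu t' ht']
        exact LinearMap.range_comp_le_range _ _)
    (fun p => by
      obtain ⟨N, s, hs, x, hx⟩ := exists_rep hσ (f p)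
      exact ⟨⟨N, s, hs⟩, x, hx⟩)
  obtain ⟨g, hg⟩ := Module.projective_lifting_property (ιLin s hs).rangeRestrict
    (f.codRestrict (LinearMap.range (ιLin s hs)) fun p => by
      have : p ∈ (⊤ : Submodule Rᵐᵒᵖ P.obj) := trivial
      rwa [← h] at this) (LinearMap.surjective_rangeRestrict _)
  exact ⟨N, s, hs, g, LinearMap.ext fun p => congrArg Subtype.val (LinearMap.congr_fun hg p)⟩

/-- A map from a finitely generated module to a term of the system that vanishes in the direct
limit vanishes in a later term. -/
theorem exists_comp_eq_zero (hσ : IsSevereRightOre σ) {P N : FPMod R} (s : M ⟶ N) (hs : σ s)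
    (g : P.obj →ₗ[Rᵐᵒᵖ] N.obj) (hg : ιLin s hs ∘ₗ g = 0) :
    ∃ (K : FPMod R) (t : N ⟶ K), σ t ∧ FPMod.lin t ∘ₗ g = 0 := by
  let J := Σ K : FPMod R, {t : N ⟶ K // σ t}
  have : Nonempty J := ⟨⟨N, 𝟙 N, σ.id_mem N⟩⟩
  -- For each `p` the element `g p` dies in some later term. The kernels of the maps from `P` to
  -- later terms are directed, so one term serves for all `p`.
  obtain ⟨⟨K, t, ht⟩, h⟩ := Submodule.exists_eq_top_of_directed
    (fun j : J => LinearMap.ker (FPMod.lin j.2.1 ∘ₗ g)) (by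
      rintro ⟨K, u, hu⟩ ⟨K', u', hu'⟩
      obtain ⟨L, t, t', ht, ht', e⟩ := hσ.exists_common hu hu'
      refine ⟨⟨L, u ≫ t, σ.comp_mem _ _ hu ht⟩, ?_, ?_⟩
      · exact LinearMap.ker_le_ker_comp (FPMod.lin u ∘ₗ g) (FPMod.lin t)
      · simp only [e]
        exact LinearMap.ker_le_ker_comp (FPMod.lin u' ∘ₗ g) (FPMod.lin t'))
    (fun p => by
      have h0 : ιLin s hs (g p) = ιLin s hs 0 := by
        rw [map_zero]
        exact LinearMap.congr_fun hg p
      obtain ⟨L, t, t', ht, ht', e, e'⟩ := exists_of_ιLin_eq hσ h0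
      refine ⟨⟨L, t, ht⟩, ?_⟩
      rw [map_zero] at e'
      exact e')
  exact ⟨K, t, ht, LinearMap.ker_eq_top.1 h⟩

/-- Maps from finitely generated projective modules to `M_σ` extend uniquely along the maps
in `σ`. -/
theorem extendsUniquely_of_projective (hσ : IsSevereRightOre σ) {P Q : FPMod R} {α : P ⟶ Q}
    (hα : σ α) [Module.Projective Rᵐᵒᵖ P.obj] [Module.Projective Rᵐᵒᵖ Q.obj] :
    extendsUniquely (dirLim σ M) α := by
  refine ⟨(injective_iff_map_eq_zero (AddMonoidHom.mk'
    (fun g : Q.obj →ₗ[Rᵐᵒᵖ] dirLim σ M => g ∘ₗ FPMod.lin α)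
    fun g g' => LinearMap.add_comp _ _ _)).2 fun f hf => ?_, fun f => ?_⟩
  · obtain ⟨N, s, hs, g, rfl⟩ := exists_factor hσ f
    obtain ⟨K, t, ht, h⟩ := exists_comp_eq_zero hσ s hs (g ∘ₗ FPMod.lin α) hf
    -- Here `α ≫ c = 0`, so the cokernel of `c` is again in `σ` and leads to a later term, in which
    -- `g` itself dies.
    let c : Q ⟶ K := FPMod.ofLin (FPMod.lin t ∘ₗ g)
    have hc : σ (FPMod.cokerπ c) := hσ.cokernel_mem α c _ (FPMod.comp_cokerπ c) hα
      (FPMod.lin_injective h) ⟨FPMod.cokerIsColimit c⟩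
    have h0 : FPMod.lin (FPMod.cokerπ c) ∘ₗ FPMod.lin t ∘ₗ g = 0 :=
      congrArg FPMod.lin (FPMod.comp_cokerπ c)
    rw [← ιLin_comp s hs t ht, ← ιLin_comp _ _ _ hc, LinearMap.comp_assoc, LinearMap.comp_assoc,
      h0, LinearMap.comp_zero]
  · obtain ⟨N, s, hs, g, rfl⟩ := exists_factor hσ f
    -- The pushout of `α` along `g` is a later term of the system, and its leg from `Q` provides the
    -- extension.
    have hp := FPMod.isPushout_push α (FPMod.ofLin g)
    have ht := hσ.pushout_mem _ _ _ _ hp hα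
    refine ⟨ιLin (s ≫ _) (σ.comp_mem _ _ hs ht) ∘ₗ FPMod.lin (FPMod.pushInl α (FPMod.ofLin g)), ?_⟩
    have e : FPMod.lin (FPMod.pushInl α (FPMod.ofLin g)) ∘ₗ FPMod.lin α =
      FPMod.lin (FPMod.pushInr α (FPMod.ofLin g)) ∘ₗ g := congrArg FPMod.lin hp.w
    change (_ ∘ₗ _) ∘ₗ FPMod.lin α = _
    rw [LinearMap.comp_assoc, e, ← LinearMap.comp_assoc, ιLin_comp _ _ _ ht]

/-! ### Universal property of `M_σ` -/

/-- A map from `M` to a module that is local for `σ` extends to `M_σ`. -/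
theorem exists_desc_of_le (hσ : IsSevereRightOre σ) {N : Type w} [AddCommGroup N]
    [Module Rᵐᵒᵖ N] (hN : σ ≤ extendsUniquely N) (f : M.obj →ₗ[Rᵐᵒᵖ] N) :
    ∃ F : dirLim σ M →ₗ[Rᵐᵒᵖ] N, F ∘ₗ ιLin (𝟙 M) (σ.id_mem M) = f := by
  -- On `M_s` the map is the unique extension of `f` along `s`; uniqueness makes these extensions
  -- compatible.
  obtain ⟨F, hF⟩ := exists_desc hσ (fun s hs => UnivLoc.extend (hN s hs) f)
    fun s hs t ht => (UnivLoc.extend_eq (hN s hs) (by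
      rw [LinearMap.comp_assoc, ← FPMod.lin_comp, UnivLoc.extend_comp])).symm
  exact ⟨F, (hF _ _).trans (UnivLoc.extend_eq _ rfl)⟩

/-- A map from `M_σ` to a module that is local for `σ` is determined by its restriction to `M`. -/
theorem hom_ext_of_le (hσ : IsSevereRightOre σ) {N : Type w} [AddCommGroup N]
    [Module Rᵐᵒᵖ N] (hN : σ ≤ extendsUniquely N) {F G : dirLim σ M →ₗ[Rᵐᵒᵖ] N}
    (h : F ∘ₗ ιLin (𝟙 M) (σ.id_mem M) = G ∘ₗ ιLin (𝟙 M) (σ.id_mem M)) : F = G := by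
  ext y
  obtain ⟨K, s, hs, x, rfl⟩ := exists_rep hσ y
  suffices H : F ∘ₗ ιLin s hs = G ∘ₗ ιLin s hs from LinearMap.congr_fun H x
  refine (hN s hs).1 ?_
  have e : ιLin s hs ∘ₗ FPMod.lin s = ιLin (𝟙 M) (σ.id_mem M) := by
    rw [← ιLin_comp (𝟙 M) (σ.id_mem M) s hs]
    simp only [Category.id_comp]
  change (F ∘ₗ ιLin s hs) ∘ₗ FPMod.lin s = (G ∘ₗ ιLin s hs) ∘ₗ FPMod.lin s
  rw [LinearMap.comp_assoc, LinearMap.comp_assoc, e, h]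

end dirLim

/-! ### Comparison of the two universal local modules -/

theorem mainTheorem12 {R : Type u} [Ring R] (Sig : MorphismProperty (FPMod R))
    (hSig : ∀ ⦃P Q : FPMod R⦄ (α : P ⟶ Q), Sig α →
      Module.Projective Rᵐᵒᵖ P.obj ∧ Module.Projective Rᵐᵒᵖ Q.obj)
    (M : FPMod R) :
    ∃ e : Induced (UnivLoc.of Sig) M.obj ≃+ dirLim (severeClosure Sig) M,
      (∀ (x : Induced (UnivLoc.of Sig) M.obj) (a : R),
        e (op (UnivLoc.of Sig a) • x) = op a • e x) ∧
      ∀ m : M.obj, e (Induced.tmul (UnivLoc.of Sig) m 1) =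
        dirLim.ι (severeClosure Sig) (𝟙 M) (MorphismProperty.id_mem _ M) m := by
  have hσ := severeClosure_isSevereRightOre Sig
  have hle : Sig ≤ severeClosure Sig := fun _ _ _ hα _ _ h => h _ hα
  have hinv := UnivLoc.invertsMaps Sig hSig
  have hI : Sig ≤ extendsUniquely (Induced (UnivLoc.of Sig) M.obj) := fun P Q α hα =>
    extendsUniquely_of_bijective_map (UnivLoc.of Sig) (fun r a => Induced.op_smul_def _ r a)
      (hinv α hα)
  have hD : Sig ≤ extendsUniquely (dirLim (severeClosure Sig) M) := fun P Q α hα => by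
    obtain ⟨_, _⟩ := hSig α hα
    exact dirLim.extendsUniquely_of_projective hσ (hle α hα)
  let unitLin : M.obj →ₗ[Rᵐᵒᵖ] Induced (UnivLoc.of Sig) M.obj :=
    { Induced.unit (UnivLoc.of Sig) with
      map_smul' := fun c m => by
        rw [← op_unop c]
        exact Induced.unit_smul _ _ _ }
  -- The maps `φ` and `ψ` come from the two universal properties. Both composites respect the
  -- canonical maps from `M`, so uniqueness makes them identities.
  obtain ⟨φ, hφ⟩ := UnivLoc.exists_desc_induced hD
    (dirLim.ιLin (σ := severeClosure Sig) (𝟙 M) (MorphismProperty.id_mem _ M))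
  obtain ⟨ψ, hψ⟩ := dirLim.exists_desc_of_le hσ (severeClosure_le_extendsUniquely hI) unitLin
  have h1 (x) : ψ (φ x) = x := UnivLoc.induced_eq_id hinv (ψ ∘ₗ φ) (fun m => by
    rw [LinearMap.comp_apply, hφ]
    exact LinearMap.congr_fun hψ m) x
  have h2 : φ ∘ₗ ψ = LinearMap.id :=
    dirLim.hom_ext_of_le hσ (severeClosure_le_extendsUniquely hD) (by
      rw [LinearMap.comp_assoc, hψ, LinearMap.id_comp]
      exact LinearMap.ext hφ)
  let e : Induced (UnivLoc.of Sig) M.obj ≃+ dirLim (severeClosure Sig) M :=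
    { toFun := φ
      invFun := ψ
      left_inv := h1
      right_inv := LinearMap.congr_fun h2
      map_add' := map_add φ }
  exact ⟨e, fun x a => φ.map_smul (op a) x, hφ⟩
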